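/- Let $(\phi_n)_{n\in\mathbb Z}$ be i.i.d. random variables with values in $[0,1]$, let $(Z_n)_{n\in\mathbb Z}$ be i.i.d. random variables with values in $\{0,1,2,\dots\}$, and let $(B_{n,k})_{n\in\mathbb Z,k\in\mathbb N}$ be $\{0,1\}$-valued random variables which, conditionally on $\Phi=(\phi_n)_{n\in\mathbb Z}$, are independent with $P(B_{n,k}=1\mid\Phi)=\phi_n$. Assume that $(Z_n)_n$ is independent of $\bigl((\phi_n)_n,(B_{n,k})_{n,k}\bigr)$. Consider the branching process with immigration in which, at each time $n$, the $k$-th individual of generation $n-1$ is replaced by one child if $B_{n,k}=1$ and by none if $B_{n,k}=0$, and $Z_n$ immigrants arrive; individuals are numbered within each generation with the most recent arrivals first. Thus the population sizes satisfy $X_n=\sum_{k=1}^{X_{n-1}}B_{n,k}+Z_n$. Let $X_{k,n}$ be the number of individuals alive at time $n$ that descend from the immigrants who arrived at time $k$ (so $X_{n,n}=Z_n$, and $X_{k,n}=0$ for $k>n$); with this numbering it is the same random variable for every starting time before $k$. Let $P_0$ be the law of the process started at time $0$ with $X_0=0$, and let $E$ be the expectation for the stationary process, started at time $-\infty$. Assume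 that $P(\phi_0=1)<1$ and that $E[Z_0^\beta]<\infty$ for some $\beta>0$. Under $P_0$, if $X_n\ge 2$, sample uniformly at random, given generation $n$, two different individuals of generation $n$, and put $T_n=n-k$ if the immigrant ancestors of both arrived at the same time $k$, and $T_n=\infty$ otherwise; put $T_n=\infty$ also if $X_n\le 1$. Then $\sum_{k\le 0}X_{k,0}<\infty$ almost surely, and, as $n\to\infty$, $T_n$ converges weakly under $P_0$ to a random variable $T$ with values in $\{0,1,2,\dots\}\cup\{\infty\}$ whose distribution function is $$P(T\le t)=F(t)=E\left[\frac{\sum_{k=-t}^{0}X_{k,0}(X_{k,0}-1)}{\Bigl(\sum_{k=-\infty}^{0}X_{k,0}\Bigr)\Bigl(\sum_{k=-\infty}^{0}X_{k,0}-1\Bigr)}\right],\qquad t=0,1,2,\dots,$$ where $0/0$ inside the expectation is interpreted as $0$. Moreover no mass is lost at infinity: $P_0(T_n=x)\to P(T=x)$ for every $x\in\{0,1,2,\dots\}\cup\{\infty\}$, including $x=\infty$. -/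

import Mathlib

open MeasureTheory ProbabilityTheory Filter Topology
open scoped ENNReal

namespace RCINAR

/-- The sublist of those members of `l` whose position `i` (counted from `0`) satisfies
`b i = true`, in their original order. -/
def survivors (b : ℕ → Bool) (l : List ℤ) : List ℤ :=
  (l.zipIdx.filter (fun p => b p.2)).map Prod.fst

/-- The population at time `s + m` of the branching process with immigration which is empty at
time `s`, given realizations `Z` of the immigration and `B` of the survival indicators.
Each individual is recorded by the time at which its immigrant ancestor entered the system.
At time `n`, the individual in position `i` of the previous generation has one child if
`B n i = true` and none otherwise, and `Z n` immigrants arrive. The newest arrivals are listed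
first, so that starting the process earlier only appends individuals at the end of the list. -/
def population (Z : ℤ → ℕ) (B : ℤ → ℕ → Bool) (s : ℤ) : ℕ → List ℤ
  | 0 => []
  | m + 1 => List.replicate (Z (s + m + 1)) (s + m + 1) ++
      survivors (B (s + m + 1)) (population Z B s m)

/-- The number of individuals alive at time `n` that descend from the immigrants who arrived at
time `k`; it is `Z n` for `k = n` and `0` for `k > n`. -/
def waveSize (Z : ℤ → ℕ) (B : ℤ → ℕ → Bool) (k n : ℤ) : ℕ :=
  (population Z B (k - 1) (n - k + 1).toNat).count k

theorem survivors_append (b : ℕ → Bool) (l l' : List ℤ) :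
    survivors b (l ++ l') = survivors b l ++ survivors (fun i => b (l.length + i)) l' := by
  unfold survivors
  rw [List.zipIdx_append, List.filter_append, List.map_append]
  congr 1
  rw [List.zipIdx_eq_map_add (l := l') (i := 0 + l.length), List.filter_map, List.map_map]
  simp [Function.comp_def]

theorem length_survivors (b : ℕ → Bool) (l : List ℤ) :
    (survivors b l).length = ∑ i ∈ Finset.range l.length, if b i then 1 else 0 := by
  induction l using List.reverseRecOn with
  | nil => simp [survivors]
  | append_singleton l a ih =>
    rw [survivors_append, List.length_append, ih, List.length_append, List.length_singleton,
      Finset.sum_range_succ]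
    by_cases h : b l.length <;> simp [survivors, h]

/-- The defining recursion of the process: the new generation consists of the surviving
offspring of the previous one and of the new immigrants. -/
theorem length_population_succ (Z : ℤ → ℕ) (B : ℤ → ℕ → Bool) (s : ℤ) (m : ℕ) :
    (population Z B s (m + 1)).length =
      (∑ i ∈ Finset.range (population Z B s m).length, if B (s + m + 1) i then 1 else 0)
        + Z (s + m + 1) := by
  rw [population, List.length_append, length_survivors, List.length_replicate, add_comm]

theorem mem_of_mem_survivors {b : ℕ → Bool} {l : List ℤ} {a : ℤ} (h : a ∈ survivors b l) :
    a ∈ l := by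
  simp only [survivors, List.mem_map, List.mem_filter] at h
  obtain ⟨p, ⟨hp, -⟩, rfl⟩ := h
  exact List.fst_mem_of_mem_zipIdx hp

/-- Starting `d` units of time earlier only appends individuals of older immigration waves. -/
theorem population_eq_append (Z : ℤ → ℕ) (B : ℤ → ℕ → Bool) (s : ℤ) (d m : ℕ) :
    ∃ l : List ℤ, population Z B (s - d) (m + d) = population Z B s m ++ l ∧ ∀ a ∈ l, a ≤ s := by
  induction m with
  | zero =>
    refine ⟨population Z B (s - d) (0 + d), by simp [population], ?_⟩
    have key : ∀ (t : ℤ) (e : ℕ), ∀ a ∈ population Z B t e, a ≤ t + e := by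
      intro t e
      induction e with
      | zero => simp [population]
      | succ e ih =>
        intro a ha
        rw [population, List.mem_append] at ha
        rcases ha with ha | ha
        · have := List.eq_of_mem_replicate ha
          push_cast; omega
        · have := ih a (mem_of_mem_survivors ha)
          push_cast; omega
    intro a ha
    have := key _ _ a ha
    push_cast at this
    omega
  | succ m ih =>
    obtain ⟨l, hl, hls⟩ := ih
    have e : m + 1 + d = (m + d) + 1 := by omega
    have e2 : s - (d : ℤ) + ((m + d : ℕ) : ℤ) + 1 = s + m + 1 := by push_cast; ring
    rw [e, population, e2, hl, survivors_append]
    exact ⟨_, by rw [population, List.append_assoc], fun a ha => hls a (mem_of_mem_survivors ha)⟩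

/-- In the process started from an empty population at time `s`, every wave `k > s` has the size
`waveSize`, whatever `s` is. -/
theorem count_population (Z : ℤ → ℕ) (B : ℤ → ℕ → Bool) (s k n : ℤ) (hs : s < k) (hk : k ≤ n) :
    (population Z B s (n - s).toNat).count k = waveSize Z B k n := by
  obtain ⟨l, hl, hls⟩ :=
    population_eq_append Z B (k - 1) (k - 1 - s).toNat (n - k + 1).toNat
  have e1 : k - 1 - ((k - 1 - s).toNat : ℤ) = s := by omega
  have e2 : (n - k + 1).toNat + (k - 1 - s).toNat = (n - s).toNat := by omega
  rw [e1, e2] at hl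
  rw [hl, List.count_append, waveSize, List.count_eq_zero_of_not_mem (l := l), add_zero]
  intro h
  have := hls k h
  omega

/-- The total size at time `0` of the stationary process, that is, of the process started at time
`-∞`: the sum over `k ≤ 0` of the sizes at time `0` of the waves `k`. -/
noncomputable def stationarySize (Z : ℤ → ℕ) (B : ℤ → ℕ → Bool) : ℝ≥0∞ :=
  ∑' j : ℕ, (waveSize Z B (-(j : ℤ)) 0 : ℝ≥0∞)

/-- The probability, given the stationary population at time `0`, that both members of a random
pair of individuals descend from the immigrants of one and the same time `k ∈ {-t, …, 0}`.
Division in `ℝ≥0∞` satisfies `0 / 0 = 0`. -/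
noncomputable def coalescenceRatio (Z : ℤ → ℕ) (B : ℤ → ℕ → Bool) (t : ℕ) : ℝ≥0∞ :=
  (∑ j ∈ Finset.range (t + 1),
      (waveSize Z B (-(j : ℤ)) 0 : ℝ≥0∞) * ((waveSize Z B (-(j : ℤ)) 0 : ℝ≥0∞) - 1)) /
    (stationarySize Z B * (stationarySize Z B - 1))

/-- The coalescence time of the individuals in positions `i` and `j` of the population `l` at
time `n`: it is `n - k` if both descend from the immigrants of time `k`, and `∞` if they descend
from immigrants of different times or if there are no two individuals to be sampled. -/
def coalescenceTime (n : ℕ) (l : List ℤ) (i j : ℕ) : ℕ∞ :=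
  if 2 ≤ l.length ∧ l.getD i 0 = l.getD j 0 then (((n : ℤ) - l.getD i 0).toNat : ℕ∞) else ⊤

instance instOpensMeasurableSpaceENat : OpensMeasurableSpace ℕ∞ := ⟨le_top⟩

variable {Ω : Type*} [MeasurableSpace Ω]

/-- The random coefficients of the model on a probability space `(Ω, P)`: the environment `φ`,
the immigration `Z`, and the survival indicators `B`, where `true` stands for `1` and the
indicators of time `n` are indexed by `ℕ` from `0`. -/
structure IsCoefficients (P : Measure Ω) (φ : ℤ → Ω → ℝ) (Z : ℤ → Ω → ℕ)
    (B : ℤ → ℕ → Ω → Bool) : Prop where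
  measurable_phi : ∀ n, Measurable (φ n)
  measurable_Z : ∀ n, Measurable (Z n)
  measurable_B : ∀ n k, Measurable (B n k)
  phi_mem : ∀ n ω, φ n ω ∈ Set.Icc (0 : ℝ) 1
  indep_phi : iIndepFun φ P
  identDistrib_phi : ∀ n, IdentDistrib (φ n) (φ 0) P P
  indep_Z : iIndepFun Z P
  identDistrib_Z : ∀ n, IdentDistrib (Z n) (Z 0) P P
  /-- The immigration is independent of the environment and the survival indicators. -/
  indep_Z_phi_B : IndepFun (fun ω n => Z n ω) (fun ω => (fun n => φ n ω, fun n k => B n k ω)) P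
  /-- Conditionally on the whole environment, the `B n k` are independent and `B n k` is
  Bernoulli with parameter `φ n`. -/
  condLaw_B : ∀ (S : Finset (ℤ × ℕ)) (b : ℤ × ℕ → Bool),
    P[Set.indicator {ω | ∀ p ∈ S, B p.1 p.2 ω = b p} (fun _ => (1 : ℝ)) |
        MeasurableSpace.comap (fun ω n => φ n ω) MeasurableSpace.pi]
      =ᵐ[P] fun ω => ∏ p ∈ S, if b p then φ p.1 ω else 1 - φ p.1 ω

/-- `(I, J)` is a uniformly random ordered pair of positions of two different members of the
random population `G`, given `G`. There is no condition where `G` has at most one member. -/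
structure IsUniformPair (P : Measure Ω) (G : Ω → List ℤ) (I J : Ω → ℕ) : Prop where
  measurable_fst : Measurable I
  measurable_snd : Measurable J
  uniform : ∀ (l : List ℤ) (i j : ℕ), i < l.length → j < l.length → i ≠ j →
    P {ω | G ω = l ∧ I ω = i ∧ J ω = j} =
      P {ω | G ω = l} / ((l.length : ℝ≥0∞) * ((l.length : ℝ≥0∞) - 1))

end RCINAR

/-! ### Deterministic structure of populations and waves -/

namespace RCINAR

/-! The immigration and the survival indicators are jointly stationary, so the population at time
`n` started empty at time `0` has, up to a translation of labels, the law of the population at time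
`0` started empty at time `-n` (`presentPopulation`). The latter populations live on one probability
space and are nested: starting one step earlier only appends the survivors of one older wave
(`presentPopulation_succ`).

Almost surely only finitely many waves are alive at time `0` (`IsCoefficients.ae_extinct`). Put `ρ =
E φ₀ < 1`. For a fixed immigration sequence `z`, wave `-j` has mean size `ρ ^ j * z (-j)` at time
`0`. For `a > 1` with `ρ * a < 1`, the wave is therefore alive with probability at most `P(Z₀ > a ^
j) + (ρ * a) ^ j`. Both terms are summable, the first by Markov's inequality for `Z₀ ^ β`, and
Borel–Cantelli applies. Hence the nested populations are eventually equal to a random finite list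
`Y`.

Given the population, the coalescence time has the law `pairLaw`, which depends on the list alone
(`IsUniformPair.measure_inter_eq`). Thus `P(T_n ∈ A)` is the mean of `pairLaw` over the population,
and dominated convergence gives its limit with `Y` in place of the population, for every set `A`.
This setwise convergence contains both the weak convergence and the convergence of all point masses,
that of `∞` included. The formula for `F` results from counting pairs in `Y` (`pairLaw_Iic`). -/

theorem count_survivors (b : ℕ → Bool) (l : List ℤ) (k : ℤ) :
    (survivors b l).count k =
      ∑ i ∈ Finset.range l.length, if l.getD i 0 = k ∧ b i then 1 else 0 := by
  induction l using List.reverseRecOn with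
  | nil => simp [survivors]
  | append_singleton l a ih =>
    rw [survivors_append, List.count_append, ih, List.length_append, List.length_singleton,
      Finset.sum_range_succ]
    congr 1
    · refine Finset.sum_congr rfl fun i hi => ?_
      rw [List.getD_append _ _ _ _ (Finset.mem_range.1 hi)]
    · rw [List.getD_append_right _ _ _ _ le_rfl]
      by_cases h : b l.length <;> simp [survivors, h, List.count_singleton]

theorem survivors_true (l : List ℤ) : survivors (fun _ => true) l = l := by
  induction l using List.reverseRecOn with
  | nil => simp [survivors]
  | append_singleton l a ih => rw [survivors_append, ih]; simp [survivors]

theorem count_eq_sum (l : List ℤ) (k : ℤ) :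
    l.count k = ∑ i ∈ Finset.range l.length, if l.getD i 0 = k then 1 else 0 := by
  conv_lhs => rw [← survivors_true l, count_survivors]
  simp

theorem survivors_map (b : ℕ → Bool) (l : List ℤ) (f : ℤ → ℤ) :
    survivors b (l.map f) = (survivors b l).map f := by
  induction l using List.reverseRecOn with
  | nil => simp [survivors]
  | append_singleton l a ih =>
    rw [List.map_append, survivors_append, survivors_append, ih, List.map_append]
    by_cases h : b l.length <;> simp [survivors, h]

variable {Z : ℤ → ℕ} {B : ℤ → ℕ → Bool}

theorem mem_population {s : ℤ} {m : ℕ} {a : ℤ} (h : a ∈ population Z B s m) :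
    s < a ∧ a ≤ s + m := by
  induction m with
  | zero => simp [population] at h
  | succ m ih =>
    rw [population, List.mem_append] at h
    rcases h with h | h
    · have := List.eq_of_mem_replicate h
      push_cast; omega
    · have := ih (mem_of_mem_survivors h)
      push_cast; omega

theorem population_add (Z : ℤ → ℕ) (B : ℤ → ℕ → Bool) (s d : ℤ) (m : ℕ) :
    population Z B (s + d) m =
      (population (fun k => Z (k + d)) (fun k => B (k + d)) s m).map (· + d) := by
  induction m with
  | zero => rfl
  | succ m ih =>
    have e : s + d + m + 1 = s + m + 1 + d := by ring
    rw [population, population, ih, survivors_map, List.map_append, List.map_replicate, e]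

/-- The population at time `0` of the process that is empty at time `-n`. -/
def presentPopulation (Z : ℤ → ℕ) (B : ℤ → ℕ → Bool) (n : ℕ) : List ℤ :=
  population Z B (-(n : ℤ)) n

/-- Moves the observation time from `n` to `0`, at the price of shifting the coefficients;
stationarity will remove that shift in law. -/
theorem population_zero_eq_map (Z : ℤ → ℕ) (B : ℤ → ℕ → Bool) (n : ℕ) :
    population Z B 0 n =
      (presentPopulation (fun k => Z (k + n)) (fun k => B (k + n)) n).map (· + (n : ℤ)) := by
  rw [presentPopulation, ← population_add, neg_add_cancel]

theorem mem_presentPopulation {n : ℕ} {a : ℤ} (h : a ∈ presentPopulation Z B n) :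
    -(n : ℤ) < a ∧ a ≤ 0 := by
  have := mem_population h
  omega

theorem count_presentPopulation {n j : ℕ} (h : j < n) :
    (presentPopulation Z B n).count (-(j : ℤ)) = waveSize Z B (-(j : ℤ)) 0 := by
  have := count_population Z B (-(n : ℤ)) (-(j : ℤ)) 0 (by omega) (by omega)
  rwa [show ((0 : ℤ) - -(n : ℤ)).toNat = n by omega] at this

/-- An appended individual has a label at most `-n`, being older than the later start, and greater
than `-(n + 1)`, having arrived after the earlier one. This leaves only the wave `-n`. -/
theorem presentPopulation_succ (Z : ℤ → ℕ) (B : ℤ → ℕ → Bool) (n : ℕ) :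
    presentPopulation Z B (n + 1) = presentPopulation Z B n ++
      List.replicate (waveSize Z B (-(n : ℤ)) 0) (-(n : ℤ)) := by
  obtain ⟨l, hl, hls⟩ := population_eq_append Z B (-(n : ℤ)) 1 n
  have e : presentPopulation Z B (n + 1) = presentPopulation Z B n ++ l := by
    rw [presentPopulation, presentPopulation, ← hl]
    congr 1
    push_cast; ring
  have hmem : ∀ a ∈ l, a = -(n : ℤ) := by
    intro a ha
    have h1 := hls a ha
    have h2 := mem_presentPopulation (Z := Z) (B := B) (n := n + 1) (a := a)
      (by rw [e]; exact List.mem_append_right _ ha)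
    push_cast at h2
    omega
  have hc := count_presentPopulation (Z := Z) (B := B) (Nat.lt_succ_self n)
  rw [Nat.succ_eq_add_one, e, List.count_append, List.count_eq_zero_of_not_mem, zero_add] at hc
  · rw [e, ← hc, List.count_eq_length.2 fun a ha => (hmem a ha).symm,
      ← List.eq_replicate_length.2 hmem]
  · intro h
    have := (mem_presentPopulation h).1
    omega

theorem length_presentPopulation (Z : ℤ → ℕ) (B : ℤ → ℕ → Bool) (n : ℕ) :
    (presentPopulation Z B n).length = ∑ j ∈ Finset.range n, waveSize Z B (-(j : ℤ)) 0 := by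
  induction n with
  | zero => rfl
  | succ n ih =>
    rw [presentPopulation_succ, List.length_append, ih, List.length_replicate,
      Finset.sum_range_succ]

theorem presentPopulation_eq_of_extinct {N n : ℕ}
    (h : ∀ j ≥ N, waveSize Z B (-(j : ℤ)) 0 = 0) (hn : N ≤ n) :
    presentPopulation Z B n = presentPopulation Z B N := by
  induction n, hn using Nat.le_induction with
  | base => rfl
  | succ n hn ih => rw [presentPopulation_succ, h n hn, ih, List.replicate_zero, List.append_nil]

theorem stationarySize_eq_of_extinct {N : ℕ} (h : ∀ j ≥ N, waveSize Z B (-(j : ℤ)) 0 = 0) :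
    stationarySize Z B = ((presentPopulation Z B N).length : ℝ≥0∞) := by
  rw [stationarySize, tsum_eq_sum (s := Finset.range N), length_presentPopulation]
  · push_cast; rfl
  · intro j hj
    rw [h j (by simpa using hj), Nat.cast_zero]

end RCINAR

/-! ### The coalescence time of a uniformly random pair -/

namespace RCINAR

/-- There are countably many lists, so with this σ-algebra every function of a population is
measurable and integrals over populations become sums. -/
instance instMeasurableSpaceListInt : MeasurableSpace (List ℤ) := ⊤

instance instDiscreteMeasurableSpaceListInt : DiscreteMeasurableSpace (List ℤ) :=
  ⟨fun _ => trivial⟩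

/-- The law of the coalescence time of a uniformly random pair of members of `l`. -/
noncomputable def pairLaw (n : ℕ) (l : List ℤ) : Measure ℕ∞ :=
  if 2 ≤ l.length then
    ((l.length : ℝ≥0∞) * ((l.length : ℝ≥0∞) - 1))⁻¹ •
      ∑ p ∈ (Finset.range l.length).offDiag, Measure.dirac (coalescenceTime n l p.1 p.2)
  else Measure.dirac ⊤

theorem cast_card_offDiag (s : Finset ℕ) :
    (s.offDiag.card : ℝ≥0∞) = (s.card : ℝ≥0∞) * ((s.card : ℝ≥0∞) - 1) := by
  rw [Finset.offDiag_card, ENNReal.natCast_sub, ENNReal.mul_sub (by simp), mul_one, Nat.cast_mul]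

theorem pairs_ne_zero {n : ℕ} (h : 2 ≤ n) : (n : ℝ≥0∞) * ((n : ℝ≥0∞) - 1) ≠ 0 := by
  have : ((n : ℝ≥0∞) - 1) = ((n - 1 : ℕ) : ℝ≥0∞) := by rw [ENNReal.natCast_sub, Nat.cast_one]
  rw [this, ← Nat.cast_mul, Nat.cast_ne_zero]
  exact mul_ne_zero (by omega) (by omega)

theorem pairs_ne_top (n : ℕ) : (n : ℝ≥0∞) * ((n : ℝ≥0∞) - 1) ≠ ∞ := by
  have : ((n : ℝ≥0∞) - 1) = ((n - 1 : ℕ) : ℝ≥0∞) := by rw [ENNReal.natCast_sub, Nat.cast_one]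
  rw [this, ← Nat.cast_mul]
  exact ENNReal.natCast_ne_top _

instance (n : ℕ) (l : List ℤ) : IsProbabilityMeasure (pairLaw n l) := by
  constructor
  unfold pairLaw
  split_ifs with h
  · simp only [Measure.smul_apply, Measure.finsetSum_apply, measure_univ, Finset.sum_const,
      nsmul_eq_mul, mul_one, smul_eq_mul]
    rw [cast_card_offDiag, Finset.card_range]
    exact ENNReal.inv_mul_cancel (pairs_ne_zero h) (pairs_ne_top _)
  · simp

theorem coalescenceTime_map_add {n : ℕ} {l : List ℤ} {i j : ℕ} (hi : i < l.length)
    (hj : j < l.length) :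
    coalescenceTime n (l.map (· + (n : ℤ))) i j = coalescenceTime 0 l i j := by
  have h (i : ℕ) (hi : i < l.length) :
      (l.map (· + (n : ℤ))).getD i 0 = l.getD i 0 + n := by
    rw [List.getD_eq_getElem _ _ (by simpa using hi), List.getD_eq_getElem _ _ hi,
      List.getElem_map]
  unfold coalescenceTime
  rw [h i hi, h j hj, List.length_map]
  simp only [add_left_inj]
  congr 3
  push_cast; ring

theorem pairLaw_map_add (n : ℕ) (l : List ℤ) :
    pairLaw n (l.map (· + (n : ℤ))) = pairLaw 0 l := by
  unfold pairLaw
  rw [List.length_map]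
  split_ifs
  · congr 1
    refine Finset.sum_congr rfl fun p hp => ?_
    rw [Finset.mem_offDiag, Finset.mem_range, Finset.mem_range] at hp
    rw [coalescenceTime_map_add hp.1 hp.2.1]
  · rfl

theorem card_filter_getD (l : List ℤ) (k : ℤ) :
    ((Finset.range l.length).filter (fun i => l.getD i 0 = k)).card = l.count k := by
  rw [count_eq_sum, Finset.card_filter]

/-- Since no label is positive, `toNat` truncates nothing, and the pairs split according to their
common label. -/
theorem filter_offDiag_coalescenceTime_le {l : List ℤ} (hl : ∀ a ∈ l, a ≤ 0)
    (hlen : 2 ≤ l.length) (t : ℕ) :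
    (Finset.range l.length).offDiag.filter (fun p => coalescenceTime 0 l p.1 p.2 ≤ t) =
      (Finset.range (t + 1)).biUnion (fun j =>
        ((Finset.range l.length).filter (fun i => l.getD i 0 = -(j : ℤ))).offDiag) := by
  ext ⟨i, k⟩
  simp only [Finset.mem_filter, Finset.mem_offDiag, Finset.mem_range, Finset.mem_biUnion,
    coalescenceTime, hlen, true_and]
  constructor
  · rintro ⟨⟨hi, hk, hne⟩, h⟩
    split_ifs at h with he
    · have : l.getD i 0 ≤ 0 := by
        rw [List.getD_eq_getElem _ 0 hi]
        exact hl _ (List.getElem_mem hi)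
      simp only [Nat.cast_le] at h
      refine ⟨(((0 : ℕ) : ℤ) - l.getD i 0).toNat, by omega, ⟨hi, ?_⟩, ⟨hk, ?_⟩, hne⟩ <;> omega
    · simp at h
  · rintro ⟨j, hj, ⟨hi, hi'⟩, ⟨hk, hk'⟩, hne⟩
    refine ⟨⟨hi, hk, hne⟩, ?_⟩
    rw [if_pos (by rw [hi', hk']), Nat.cast_le]
    omega

theorem pairLaw_Iic {l : List ℤ} (hl : ∀ a ∈ l, a ≤ 0) (t : ℕ) :
    pairLaw 0 l (Set.Iic (t : ℕ∞)) =
      (∑ j ∈ Finset.range (t + 1),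
        (l.count (-(j : ℤ)) : ℝ≥0∞) * ((l.count (-(j : ℤ)) : ℝ≥0∞) - 1)) /
      ((l.length : ℝ≥0∞) * ((l.length : ℝ≥0∞) - 1)) := by
  unfold pairLaw
  split_ifs with h
  · rw [ENNReal.div_eq_inv_mul, Measure.smul_apply, smul_eq_mul, Measure.finsetSum_apply]
    congr 1
    simp_rw [Measure.dirac_apply, Set.indicator_apply, Set.mem_Iic, Pi.one_apply]
    rw [← Finset.sum_filter, Finset.sum_const, nsmul_eq_mul, mul_one,
      filter_offDiag_coalescenceTime_le hl h, Finset.card_biUnion]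
    · push_cast
      refine Finset.sum_congr rfl fun j _ => ?_
      rw [cast_card_offDiag, card_filter_getD]
    · intro i _ j _ hij
      rw [Function.onFun, Finset.disjoint_left]
      rintro p hp hp'
      simp only [Finset.mem_offDiag, Finset.mem_filter] at hp hp'
      omega
  -- With at most one individual every count is at most `1`, so truncated subtraction annihilates
  -- the numerator. The convention `0 / 0 = 0` then agrees with the unit mass at `⊤`.
  · rw [Finset.sum_eq_zero, ENNReal.zero_div]
    · simp
    · intro j _
      have : l.count (-(j : ℤ)) ≤ 1 := List.count_le_length.trans (by omega)
      rw [tsub_eq_zero_of_le (by exact_mod_cast this), mul_zero]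

variable {Ω : Type*} [MeasurableSpace Ω] {P : Measure Ω}

theorem IsUniformPair.measurable_coalescenceTime {G : Ω → List ℤ} {I J : Ω → ℕ}
    (h : IsUniformPair P G I J) (hG : Measurable G) (n : ℕ) :
    Measurable (fun ω => coalescenceTime n (G ω) (I ω) (J ω)) :=
  (measurable_of_countable (fun x : List ℤ × ℕ × ℕ => coalescenceTime n x.1 x.2.1 x.2.2)).comp
    (hG.prodMk (h.measurable_fst.prodMk h.measurable_snd))

/-- `pairLaw` is the conditional law of the coalescence time given the population. -/
theorem IsUniformPair.measure_inter_eq [IsProbabilityMeasure P] {G : Ω → List ℤ} {I J : Ω → ℕ}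
    (h : IsUniformPair P G I J) (hG : Measurable G) (n : ℕ) (A : Set ℕ∞) (l : List ℤ) :
    P ({ω | coalescenceTime n (G ω) (I ω) (J ω) ∈ A} ∩ G ⁻¹' {l}) =
      pairLaw n l A * P (G ⁻¹' {l}) := by
  classical
  have hI := h.measurable_fst
  have hJ := h.measurable_snd
  unfold pairLaw
  split_ifs with hlen
  · set D := (Finset.range l.length).offDiag
    set E : ℕ × ℕ → Set Ω := fun p => {ω | G ω = l ∧ I ω = p.1 ∧ J ω = p.2}
    set c : ℝ≥0∞ := (l.length : ℝ≥0∞) * ((l.length : ℝ≥0∞) - 1)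
    have hE (p) : MeasurableSet (E p) :=
      (hG (measurableSet_singleton l)).inter
        ((hI (measurableSet_singleton p.1)).inter (hJ (measurableSet_singleton p.2)))
    have hdisj : Set.PairwiseDisjoint (D : Set (ℕ × ℕ)) E := by
      intro p _ q _ hpq
      rw [Function.onFun, Set.disjoint_left]
      rintro ω ⟨_, h1, h2⟩ ⟨_, h3, h4⟩
      exact hpq (Prod.ext (h1.symm.trans h3) (h2.symm.trans h4))
    have hPE : ∀ p ∈ D, P (E p) = P (G ⁻¹' {l}) / c := by
      intro p hp
      rw [Finset.mem_offDiag, Finset.mem_range, Finset.mem_range] at hp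
      exact h.uniform l p.1 p.2 hp.1 hp.2.1 hp.2.2
    -- The prescribed probabilities of the admissible pairs already add up to the whole mass of `G =
    -- l`. So inadmissible positions, which `IsUniformPair` does not exclude pointwise, form a null
    -- set there.
    have hunion : P (⋃ p ∈ D, E p) = P (G ⁻¹' {l}) := by
      rw [measure_biUnion_finset hdisj (fun p _ => hE p), Finset.sum_congr rfl hPE,
        Finset.sum_const, nsmul_eq_mul, cast_card_offDiag, Finset.card_range]
      exact ENNReal.mul_div_cancel (pairs_ne_zero hlen) (pairs_ne_top _)
    have hsub : (⋃ p ∈ D, E p) ⊆ G ⁻¹' {l} := by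
      intro ω hω
      simp only [Set.mem_iUnion] at hω
      obtain ⟨p, _, hω⟩ := hω
      exact hω.1
    have hae : (⋃ p ∈ D, E p) =ᵐ[P] G ⁻¹' {l} :=
      ae_eq_of_subset_of_measure_ge hsub hunion.ge
        (Finset.measurableSet_biUnion _ fun p _ => hE p).nullMeasurableSet (measure_ne_top _ _)
    rw [← measure_congr ((ae_eq_refl _).inter hae), Set.inter_iUnion₂, measure_biUnion_finset,
      Measure.smul_apply, smul_eq_mul, Measure.finsetSum_apply, mul_assoc, mul_comm, Finset.sum_mul,
      Finset.sum_mul]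
    · refine Finset.sum_congr rfl fun p hp => ?_
      rw [Measure.dirac_apply, Set.indicator_apply]
      split_ifs with hA
      · rw [Set.inter_eq_self_of_subset_right, hPE p hp, Pi.one_apply, one_mul, div_eq_mul_inv]
        rintro ω ⟨h1, h2, h3⟩
        rwa [Set.mem_ofPred_eq, h1, h2, h3]
      · rw [Set.disjoint_iff_inter_eq_empty.1, measure_empty, zero_mul, zero_mul]
        rw [Set.disjoint_left]
        rintro ω hω ⟨h1, h2, h3⟩
        rw [Set.mem_ofPred_eq, h1, h2, h3] at hω
        exact hA hω
    · intro p hp q hq hpq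
      exact (hdisj hp hq hpq).mono Set.inter_subset_right Set.inter_subset_right
    · intro p _
      exact (h.measurable_coalescenceTime hG n
        (DiscreteMeasurableSpace.forall_measurableSet A)).inter (hE p)
  · have key : ∀ ω ∈ G ⁻¹' {l}, coalescenceTime n (G ω) (I ω) (J ω) = ⊤ := by
      intro ω hω
      rw [Set.mem_preimage, Set.mem_singleton_iff] at hω
      rw [hω, coalescenceTime, if_neg (fun h => hlen h.1)]
    rw [Measure.dirac_apply, Set.indicator_apply]
    split_ifs with hA
    · rw [Set.inter_eq_self_of_subset_right, Pi.one_apply, one_mul]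
      intro ω hω
      rwa [Set.mem_ofPred_eq, key ω hω]
    · rw [Set.disjoint_iff_inter_eq_empty.1, measure_empty, zero_mul]
      rw [Set.disjoint_left]
      intro ω hω hω'
      rw [Set.mem_ofPred_eq, key ω hω'] at hω
      exact hA hω

theorem IsUniformPair.measure_coalescenceTime [IsProbabilityMeasure P] {G : Ω → List ℤ}
    {I J : Ω → ℕ}
    (h : IsUniformPair P G I J) (hG : Measurable G) (n : ℕ) (A : Set ℕ∞) :
    P {ω | coalescenceTime n (G ω) (I ω) (J ω) ∈ A} = ∫⁻ ω, pairLaw n (G ω) A ∂P := by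
  have hm := h.measurable_coalescenceTime hG n (DiscreteMeasurableSpace.forall_measurableSet A)
  rw [← lintegral_map (f := fun l => pairLaw n l A) (measurable_of_countable _) hG,
    lintegral_countable']
  simp_rw [Measure.map_apply hG (measurableSet_singleton _), ← h.measure_inter_eq hG]
  rw [← measure_iUnion, ← Set.inter_iUnion, ← Set.preimage_iUnion, Set.iUnion_of_singleton,
    Set.preimage_univ, Set.inter_univ]
  · intro l l' hll
    exact ((Set.disjoint_singleton.2 hll).preimage G).mono Set.inter_subset_right
      Set.inter_subset_right
  · exact fun l => hm.inter (hG (measurableSet_singleton l))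

end RCINAR

/-! ### Measurability, stationarity and independence of the coefficients -/

namespace RCINAR

theorem measurable_survivors :
    Measurable (fun x : (ℕ → Bool) × List ℤ => survivors x.1 x.2) := by
  refine measurable_from_prod_countable_left fun l => ?_
  change Measurable fun b : ℕ → Bool => survivors b l
  induction l using List.reverseRecOn with
  | nil => exact measurable_const
  | append_singleton l a ih =>
    simp_rw [survivors_append]
    have h : Measurable fun b : ℕ → Bool => survivors (fun i => b (l.length + i)) [a] := by
      have : (fun b : ℕ → Bool => survivors (fun i => b (l.length + i)) [a]) =
          (fun c : Bool => if c then [a] else []) ∘ (fun b => b l.length) := by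
        funext b
        by_cases h : b l.length <;> simp [survivors, h]
      rw [this]
      exact (measurable_of_countable _).comp (measurable_pi_apply _)
    exact (measurable_of_countable (fun x : List ℤ × List ℤ => x.1 ++ x.2)).comp (ih.prodMk h)

theorem measurable_population (s : ℤ) (m : ℕ) :
    Measurable (fun x : (ℤ → ℕ) × (ℤ → ℕ → Bool) => population x.1 x.2 s m) := by
  induction m with
  | zero => exact measurable_const
  | succ m ih =>
    have h1 : Measurable fun x : (ℤ → ℕ) × (ℤ → ℕ → Bool) => x.1 (s + m + 1) := by fun_prop
    have h2 : Measurable fun x : (ℤ → ℕ) × (ℤ → ℕ → Bool) =>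
        survivors (x.2 (s + m + 1)) (population x.1 x.2 s m) :=
      measurable_survivors.comp (Measurable.prodMk (by fun_prop) ih)
    exact (measurable_of_countable
      (fun x : ℕ × List ℤ => List.replicate x.1 (s + m + 1) ++ x.2)).comp (h1.prodMk h2)

theorem measurable_waveSize (k n : ℤ) :
    Measurable (fun x : (ℤ → ℕ) × (ℤ → ℕ → Bool) => waveSize x.1 x.2 k n) :=
  (measurable_of_countable (List.count k)).comp (measurable_population _ _)

theorem population_congr (Z : ℤ → ℕ) {B B' : ℤ → ℕ → Bool} {s : ℤ} {m : ℕ}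
    (h : ∀ k ≤ s + m, B k = B' k) : population Z B s m = population Z B' s m := by
  induction m with
  | zero => rfl
  | succ m ih =>
    rw [population, population, ih fun k hk => h k (by push_cast; omega),
      h (s + m + 1) (by push_cast; omega)]

theorem measurableSet_cylinder {ι : Type*} (S : Finset ι) (b : ι → Bool) :
    MeasurableSet {x : ι → Bool | ∀ p ∈ S, x p = b p} := by
  have : {x : ι → Bool | ∀ p ∈ S, x p = b p} = ⋂ p ∈ S, (fun x => x p) ⁻¹' {b p} := by
    ext x; simp
  rw [this]
  exact Finset.measurableSet_biInter _ fun p _ => measurable_pi_apply p (measurableSet_singleton _)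

/-- Finite measures on a space of binary families are determined by the cylinders. -/
theorem measure_ext_of_cylinder {ι : Type*} {μ ν : Measure (ι → Bool)} [IsFiniteMeasure μ]
    (h : ∀ (S : Finset ι) (b : ι → Bool), μ {x | ∀ p ∈ S, x p = b p} = ν {x | ∀ p ∈ S, x p = b p}) :
    μ = ν := by
  classical
  refine ext_of_generate_finite
    (Set.range fun q : Finset ι × (ι → Bool) => {x : ι → Bool | ∀ p ∈ q.1, x p = q.2 p})
    (le_antisymm ?_ ?_) ?_ ?_ ?_
  · refine iSup_le fun i => ?_
    rintro _ ⟨s, -, rfl⟩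
    have hi (c : Bool) : MeasurableSet[MeasurableSpace.generateFrom (Set.range
        fun q : Finset ι × (ι → Bool) => {x : ι → Bool | ∀ p ∈ q.1, x p = q.2 p})]
        {x : ι → Bool | x i = c} :=
      MeasurableSpace.measurableSet_generateFrom ⟨({i}, fun _ => c), by simp⟩
    have : (fun x : ι → Bool => x i) ⁻¹' s = ⋃ c ∈ s, {x : ι → Bool | x i = c} := by
      ext x; simp
    rw [this]
    exact MeasurableSet.biUnion (Set.to_countable s) fun c _ => hi c
  · refine MeasurableSpace.generateFrom_le ?_
    rintro _ ⟨⟨S, b⟩, rfl⟩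
    exact measurableSet_cylinder S b
  · rintro _ ⟨⟨S, b⟩, rfl⟩ _ ⟨⟨S', b'⟩, rfl⟩ ⟨y, hy, hy'⟩
    refine ⟨(S ∪ S', y), ?_⟩
    ext x
    simp only [Set.mem_ofPred_eq, Set.mem_inter_iff, Finset.mem_union] at hy hy' ⊢
    constructor
    · exact fun h => ⟨fun p hp => (h p (.inl hp)).trans (hy p hp),
        fun p hp => (h p (.inr hp)).trans (hy' p hp)⟩
    · rintro ⟨h, h'⟩ p (hp | hp)
      · rw [h p hp, hy p hp]
      · rw [h' p hp, hy' p hp]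
  · rintro _ ⟨⟨S, b⟩, rfl⟩
    exact h S b
  · simpa using h ∅ fun _ => true

theorem map_shift_eq {Ω α : Type*} [MeasurableSpace Ω] [MeasurableSpace α] {P : Measure Ω}
    [IsProbabilityMeasure P] {X : ℤ → Ω → α} (hX : ∀ n, Measurable (X n)) (hind : iIndepFun X P)
    (hid : ∀ n, IdentDistrib (X n) (X 0) P P) (d : ℤ) :
    P.map (fun ω n => X (n + d) ω) = P.map (fun ω n => X n ω) := by
  have hs : iIndepFun (fun n => X (n + d)) P := hind.precomp (add_left_injective d)
  rw [hs.map_fun_eq_infinitePi_map fun n => hX _, hind.map_fun_eq_infinitePi_map hX]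
  congr 1
  funext n
  rw [(hid _).map_eq, (hid n).map_eq]

variable {Ω : Type*} [MeasurableSpace Ω] {P : Measure Ω}
  {φ : ℤ → Ω → ℝ} {Z : ℤ → Ω → ℕ} {B : ℤ → ℕ → Ω → Bool}

namespace IsCoefficients

theorem measurable_coefficients (h : IsCoefficients P φ Z B) (d : ℤ) :
    Measurable (fun ω => ((fun n => Z (n + d) ω, fun n k => B (n + d) k ω) :
      (ℤ → ℕ) × (ℤ → ℕ → Bool))) :=
  (measurable_pi_iff.2 fun _ => h.measurable_Z _).prodMk
    (measurable_pi_iff.2 fun _ => measurable_pi_iff.2 fun k => h.measurable_B _ k)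

theorem indep_Z_B (h : IsCoefficients P φ Z B) :
    IndepFun (fun ω n => Z n ω) (fun ω n k => B n k ω) P :=
  h.indep_Z_phi_B.comp measurable_id measurable_snd

variable [IsProbabilityMeasure P]

theorem measureReal_cylinder (h : IsCoefficients P φ Z B) (S : Finset (ℤ × ℕ))
    (b : ℤ × ℕ → Bool) :
    P.real {ω | ∀ p ∈ S, B p.1 p.2 ω = b p} =
      ∫ ω, ∏ p ∈ S, (if b p then φ p.1 ω else 1 - φ p.1 ω) ∂P := by
  have hB : Measurable fun ω (p : ℤ × ℕ) => B p.1 p.2 ω :=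
    measurable_pi_iff.2 fun p => h.measurable_B _ _
  have hle : MeasurableSpace.comap (fun ω n => φ n ω) MeasurableSpace.pi ≤ ‹MeasurableSpace Ω› :=
    (measurable_pi_iff.2 h.measurable_phi).comap_le
  rw [← integral_congr_ae (h.condLaw_B S b), integral_condExp hle,
    integral_indicator (show MeasurableSet {ω | ∀ p ∈ S, B p.1 p.2 ω = b p} from
      hB (measurableSet_cylinder S b)), setIntegral_const, smul_eq_mul, mul_one]

theorem integral_prod_shift (h : IsCoefficients P φ Z B) (S : Finset (ℤ × ℕ)) (b : ℤ × ℕ → Bool)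
    (d : ℤ) :
    ∫ ω, ∏ p ∈ S, (if b p then φ (p.1 + d) ω else 1 - φ (p.1 + d) ω) ∂P =
      ∫ ω, ∏ p ∈ S, (if b p then φ p.1 ω else 1 - φ p.1 ω) ∂P := by
  have hf : Measurable fun x : ℤ → ℝ => ∏ p ∈ S, (if b p then x p.1 else 1 - x p.1) := by
    refine Finset.measurable_fun_prod _ fun p _ => ?_
    split_ifs <;> fun_prop
  have h1 := integral_map (μ := P) (φ := fun ω n => φ (n + d) ω)
    (measurable_pi_iff.2 fun n => h.measurable_phi _).aemeasurable hf.aestronglyMeasurable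
  have h2 := integral_map (μ := P) (φ := fun ω n => φ n ω)
    (measurable_pi_iff.2 fun n => h.measurable_phi _).aemeasurable hf.aestronglyMeasurable
  rw [← h1, ← h2, map_shift_eq h.measurable_phi h.indep_phi h.identDistrib_phi]

/-- Cylinder probabilities are integrals of a function of the environment, whose law is shift
invariant, and cylinders determine the law. -/
theorem map_B_shift (h : IsCoefficients P φ Z B) (d : ℤ) :
    P.map (fun ω n k => B (n + d) k ω) = P.map (fun ω n k => B n k ω) := by
  have hB (d : ℤ) : Measurable fun ω (p : ℤ × ℕ) => B (p.1 + d) p.2 ω :=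
    measurable_pi_iff.2 fun p => h.measurable_B _ _
  have hB0 : Measurable fun ω (p : ℤ × ℕ) => B p.1 p.2 ω :=
    measurable_pi_iff.2 fun p => h.measurable_B _ _
  have hc : Measurable fun (x : ℤ × ℕ → Bool) (n : ℤ) (k : ℕ) => x (n, k) := by fun_prop
  have key : P.map (fun ω (p : ℤ × ℕ) => B (p.1 + d) p.2 ω) =
      P.map (fun ω (p : ℤ × ℕ) => B p.1 p.2 ω) := by
    have := Measure.isFiniteMeasure_map P (fun ω (p : ℤ × ℕ) => B (p.1 + d) p.2 ω)
    refine measure_ext_of_cylinder fun S b => ?_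
    rw [Measure.map_apply (hB d) (measurableSet_cylinder S b),
      Measure.map_apply hB0 (measurableSet_cylinder S b)]
    rw [← measureReal_eq_measureReal_iff]
    have h2 := h.measureReal_cylinder S b
    rw [← h.integral_prod_shift S b d] at h2
    refine Eq.trans ?_ h2.symm
    -- A cylinder event for the shifted indicators is one for the original indicators over the
    -- translated index set.
    let e : ℤ × ℕ ↪ ℤ × ℕ := ⟨fun p => (p.1 + d, p.2), fun p q hpq => by
      simp only [Prod.mk.injEq, add_left_inj] at hpq
      exact Prod.ext hpq.1 hpq.2⟩
    have h3 := h.measureReal_cylinder (S.map e) (fun p => b (p.1 - d, p.2))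
    have he (p) : e p = (p.1 + d, p.2) := rfl
    simp only [Finset.prod_map, he, add_sub_cancel_right,
      Finset.mem_map, forall_exists_index, and_imp, forall_apply_eq_imp_iff₂] at h3
    exact h3
  have := congrArg (Measure.map fun (x : ℤ × ℕ → Bool) (n : ℤ) (k : ℕ) => x (n, k)) key
  rwa [Measure.map_map hc (hB d), Measure.map_map hc hB0] at this

theorem map_coefficients (h : IsCoefficients P φ Z B) :
    P.map (fun ω => (fun n => Z n ω, fun n k => B n k ω)) =
      (P.map fun ω n => Z n ω).prod (P.map fun ω n k => B n k ω) :=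
  (indepFun_iff_map_prod_eq_prod_map_map
    (measurable_pi_iff.2 h.measurable_Z).aemeasurable
    (measurable_pi_iff.2 fun n => measurable_pi_iff.2 fun k => h.measurable_B n k).aemeasurable).1
    h.indep_Z_B

/-- The joint law of immigration and survival indicators is stationary. -/
theorem map_coefficients_shift (h : IsCoefficients P φ Z B) (d : ℤ) :
    P.map (fun ω => (fun n => Z (n + d) ω, fun n k => B (n + d) k ω)) =
      P.map (fun ω => (fun n => Z n ω, fun n k => B n k ω)) := by
  have hz : Measurable fun (z : ℤ → ℕ) (n : ℤ) => z (n + d) := by fun_prop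
  have hb : Measurable fun (x : ℤ → ℕ → Bool) (n : ℤ) (k : ℕ) => x (n + d) k := by fun_prop
  have hind : IndepFun (fun ω n => Z (n + d) ω) (fun ω n k => B (n + d) k ω) P :=
    h.indep_Z_B.comp hz hb
  rw [h.map_coefficients, (indepFun_iff_map_prod_eq_prod_map_map
    (measurable_pi_iff.2 fun n => h.measurable_Z _).aemeasurable
    (measurable_pi_iff.2 fun n => measurable_pi_iff.2 fun k => h.measurable_B _ k).aemeasurable).1
    hind, h.map_B_shift, map_shift_eq h.measurable_Z h.indep_Z h.identDistrib_Z]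

theorem integrable_phi (h : IsCoefficients P φ Z B) (n : ℤ) : Integrable (φ n) P :=
  Integrable.of_bound (h.measurable_phi n).aestronglyMeasurable 1
    (ae_of_all _ fun ω => by
      rw [Real.norm_eq_abs, abs_of_nonneg (h.phi_mem n ω).1]; exact (h.phi_mem n ω).2)

theorem integral_phi_lt_one (h : IsCoefficients P φ Z B) (h1 : P {ω | φ 0 ω = 1} < 1) :
    ∫ ω, φ 0 ω ∂P < 1 := by
  have hint := h.integrable_phi 0
  have hle : ∫ ω, φ 0 ω ∂P ≤ 1 := by
    simpa using integral_mono hint (integrable_const 1) fun ω => (h.phi_mem 0 ω).2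
  refine lt_of_le_of_ne hle fun heq => h1.ne ?_
  have h0 : ∫ ω, (1 - φ 0 ω) ∂P = 0 := by
    rw [integral_sub (integrable_const 1) hint, heq]; simp
  rw [integral_eq_zero_iff_of_nonneg (fun ω => sub_nonneg.2 (h.phi_mem 0 ω).2)
    ((integrable_const 1).sub hint)] at h0
  have hm : MeasurableSet {ω | φ 0 ω = 1} := h.measurable_phi 0 (measurableSet_singleton 1)
  rw [← mem_ae_iff_prob_eq_one hm]
  filter_upwards [h0] with ω hω
  have : 1 - φ 0 ω = 0 := hω
  change φ 0 ω = 1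
  linarith

/-- A survival indicator of time `n` is independent of the indicators of earlier times. -/
theorem measure_inter_past (h : IsCoefficients P φ Z B) (n : ℤ) (i : ℕ)
    {A : Set ({p : ℤ × ℕ // p.1 < n} → Bool)} (hA : MeasurableSet A) :
    P ({ω | B n i ω = true} ∩ (fun ω p => B p.1.1 p.1.2 ω) ⁻¹' A) =
      ENNReal.ofReal (∫ ω, φ 0 ω ∂P) * P ((fun ω p => B p.1.1 p.1.2 ω) ⁻¹' A) := by
  classical
  set past : Ω → {p : ℤ × ℕ // p.1 < n} → Bool := fun ω p => B p.1.1 p.1.2 ω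
  have hpast : Measurable past := measurable_pi_iff.2 fun p => h.measurable_B _ _
  have hρ : 0 ≤ ∫ ω, φ 0 ω ∂P := integral_nonneg fun ω => (h.phi_mem 0 ω).1
  suffices hμ : (P.restrict {ω | B n i ω = true}).map past =
      ENNReal.ofReal (∫ ω, φ 0 ω ∂P) • P.map past by
    have := congrArg (fun μ => μ A) hμ
    rwa [Measure.map_apply hpast hA, Measure.restrict_apply (hpast hA), Measure.smul_apply,
      Measure.map_apply hpast hA, smul_eq_mul, Set.inter_comm] at this
  refine measure_ext_of_cylinder fun S b => ?_
  have hS := measurableSet_cylinder S b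
  rw [Measure.map_apply hpast hS, Measure.restrict_apply (hpast hS), Measure.smul_apply,
    Measure.map_apply hpast hS, smul_eq_mul, ← ENNReal.toReal_eq_toReal_iff' (by finiteness)
    (by finiteness), ENNReal.toReal_mul, ENNReal.toReal_ofReal hρ]
  set S' : Finset (ℤ × ℕ) := S.map (Function.Embedding.subtype _)
  -- The value `true` outside the past makes the intersection with survival at `(n, i)` again a
  -- cylinder, over `insert (n, i) S'`.
  set b' : ℤ × ℕ → Bool := fun p => if hp : p.1 < n then b ⟨p, hp⟩ else true
  have hb' (p) (hp : p ∈ S) : b' p.1 = b p := by simp only [b', p.2, dif_pos]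
  have hni : (n, i) ∉ S' := by
    simp [S']
  have e1 : past ⁻¹' {x | ∀ p ∈ S, x p = b p} = {ω | ∀ p ∈ S', B p.1 p.2 ω = b' p} := by
    ext ω
    simp only [S', Set.mem_preimage, Set.mem_ofPred_eq, Finset.mem_map, forall_exists_index,
      and_imp, forall_apply_eq_imp_iff₂, Function.Embedding.subtype_apply]
    exact forall₂_congr fun p hp => by rw [hb' p hp]
  have e2 : past ⁻¹' {x | ∀ p ∈ S, x p = b p} ∩ {ω | B n i ω = true} =
      {ω | ∀ p ∈ insert (n, i) S', B p.1 p.2 ω = b' p} := by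
    rw [e1]
    ext ω
    simp [b', and_comm]
  rw [e2, e1]
  refine (h.measureReal_cylinder _ _).trans ?_
  refine Eq.trans ?_ (congrArg _ (h.measureReal_cylinder S' b').symm)
  simp_rw [Finset.prod_insert hni]
  have hbn : b' (n, i) = true := by simp [b']
  simp only [hbn, if_true]
  have hdisj : Disjoint {n} (S'.image Prod.fst) := by
    simp only [Finset.disjoint_singleton_left, Finset.mem_image, S', Finset.mem_map]
    rintro ⟨_, ⟨p, _, rfl⟩, hp⟩
    exact p.2.ne hp
  -- The past cylinder involves only environments of times before `n`, which are independent of `φ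
  -- n`, so the integral factorizes.
  have hind := h.indep_phi.indepFun_finset {n} (S'.image Prod.fst) hdisj h.measurable_phi
  have hg : Measurable fun x : S'.image Prod.fst → ℝ => ∏ p ∈ S'.attach,
      (if b' p.1 then x ⟨p.1.1, Finset.mem_image_of_mem _ p.2⟩
        else 1 - x ⟨p.1.1, Finset.mem_image_of_mem _ p.2⟩) := by
    refine Finset.measurable_fun_prod _ fun p _ => ?_
    split_ifs <;> fun_prop
  have hn : Measurable fun x : ({n} : Finset ℤ) → ℝ => x ⟨n, Finset.mem_singleton_self n⟩ :=
    measurable_pi_apply _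
  have hind' := hind.comp hn hg
  have hmul := hind'.integral_fun_mul_eq_mul_integral
    ((h.measurable_phi n).aestronglyMeasurable)
    ((hg.comp (measurable_pi_iff.2 fun k => h.measurable_phi k)).aestronglyMeasurable)
  simp only [Function.comp_apply] at hmul
  rw [(h.identDistrib_phi n).integral_eq] at hmul
  have e3 (ω : Ω) := Finset.prod_attach S' (fun p => if b' p then φ p.1 ω else 1 - φ p.1 ω)
  simp_rw [e3] at hmul
  exact hmul

end IsCoefficients

end RCINAR

/-! ### Extinction of old waves -/

namespace RCINAR

/-- The index set no longer depends on the list, so the sum can be exchanged with an expectation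
over random lists. -/
theorem count_survivors_eq_tsum (b : ℕ → Bool) (l : List ℤ) (k : ℤ) :
    ((survivors b l).count k : ℝ≥0∞) =
      ∑' i, if b i = true ∧ i < l.length ∧ l.getD i 0 = k then 1 else 0 := by
  rw [count_survivors, tsum_eq_sum (s := Finset.range l.length)]
  · push_cast
    refine Finset.sum_congr rfl fun i hi => ?_
    have := Finset.mem_range.1 hi
    simp [this, and_comm]
  · intro i hi
    rw [Finset.mem_range] at hi
    simp [hi]

theorem count_eq_tsum (l : List ℤ) (k : ℤ) :
    (l.count k : ℝ≥0∞) = ∑' i, if i < l.length ∧ l.getD i 0 = k then 1 else 0 := by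
  conv_lhs => rw [← survivors_true l, count_survivors_eq_tsum]
  simp

variable {Ω : Type*} [MeasurableSpace Ω] {P : Measure Ω}
  {φ : ℤ → Ω → ℝ} {Z : ℤ → Ω → ℕ} {B : ℤ → ℕ → Ω → Bool}

namespace IsCoefficients

theorem measurable_population_right (h : IsCoefficients P φ Z B) (z : ℤ → ℕ) (s : ℤ) (m : ℕ) :
    Measurable fun ω => population z (fun n k => B n k ω) s m :=
  (measurable_population s m).comp (measurable_const.prodMk
    (measurable_pi_iff.2 fun n => measurable_pi_iff.2 fun k => h.measurable_B n k))

variable [IsProbabilityMeasure P]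

theorem measure_survives_inter (h : IsCoefficients P φ Z B) (z : ℤ → ℕ) {s n : ℤ} {m : ℕ}
    (hn : s + m < n) (i : ℕ) (Q : Set (List ℤ)) :
    P {ω | B n i ω = true ∧ population z (fun n k => B n k ω) s m ∈ Q} =
      ENNReal.ofReal (∫ ω, φ 0 ω ∂P) * P {ω | population z (fun n k => B n k ω) s m ∈ Q} := by
  -- Exhibits the population at time `s + m` as a function of the indicators before `n`; the value
  -- `false` elsewhere is never read.
  let extend (x : {p : ℤ × ℕ // p.1 < n} → Bool) (a : ℤ) (c : ℕ) : Bool :=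
    if ha : a < n then x ⟨(a, c), ha⟩ else false
  have hext : Measurable extend := by
    refine measurable_pi_iff.2 fun a => measurable_pi_iff.2 fun c => ?_
    by_cases ha : a < n
    · simp only [extend, ha, dif_pos]; fun_prop
    · simp only [extend, ha, dif_neg, not_false_eq_true]; fun_prop
  have hA : MeasurableSet {x | population z (extend x) s m ∈ Q} :=
    (measurable_population s m).comp (measurable_const.prodMk hext)
      (DiscreteMeasurableSpace.forall_measurableSet Q)
  have hpop (ω : Ω) : population z (extend fun p => B p.1.1 p.1.2 ω) s m =
      population z (fun n k => B n k ω) s m := by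
    refine population_congr z fun k hk => ?_
    funext c
    simp only [extend]
    rw [dif_pos (by omega)]
  have he : (fun ω (p : {p : ℤ × ℕ // p.1 < n}) => B p.1.1 p.1.2 ω) ⁻¹'
      {x | population z (extend x) s m ∈ Q} =
        {ω | population z (fun n k => B n k ω) s m ∈ Q} := by
    ext ω
    simp only [Set.mem_preimage, Set.mem_ofPred_eq, hpop]
  have := h.measure_inter_past n i hA
  rw [he] at this
  exact this

/-- Each generation multiplies the mean by `E φ₀`. Indicators of the same time are dependent through
their common `φ n`, but linearity of expectation only needs each one to be independent of the past.
-/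
theorem lintegral_count_population (h : IsCoefficients P φ Z B) (z : ℤ → ℕ) (k : ℤ) (m : ℕ) :
    ∫⁻ ω, ((population z (fun n k => B n k ω) (k - 1) (m + 1)).count k : ℝ≥0∞) ∂P =
      ENNReal.ofReal (∫ ω, φ 0 ω ∂P) ^ m * z k := by
  induction m with
  | zero =>
    simp [population, survivors]
  | succ m ih =>
    set n : ℤ := k - 1 + (m + 1 : ℕ) + 1 with hn
    set l : Ω → List ℤ := fun ω => population z (fun n k => B n k ω) (k - 1) (m + 1) with hl
    have hlm : Measurable l := h.measurable_population_right z _ _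
    let E (i : ℕ) : Set (List ℤ) := {l | i < l.length ∧ l.getD i 0 = k}
    have hcount (ω : Ω) :
        ((population z (fun n k => B n k ω) (k - 1) (m + 1 + 1)).count k : ℝ≥0∞) =
          ∑' i, {ω | B n i ω = true ∧ l ω ∈ E i}.indicator 1 ω := by
      rw [population, List.count_append, List.count_replicate, if_neg, zero_add,
        count_survivors_eq_tsum]
      · simp only [Set.indicator_apply, Set.mem_ofPred_eq, Pi.one_apply]
        rfl
      · simp only [beq_iff_eq]
        push_cast
        omega
    have hQ (i : ℕ) : MeasurableSet {ω | l ω ∈ E i} :=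
      hlm (DiscreteMeasurableSpace.forall_measurableSet (E i))
    have hm (i : ℕ) : MeasurableSet
        {ω | B n i ω = true ∧ l ω ∈ E i} :=
      MeasurableSet.inter (h.measurable_B n i (measurableSet_singleton true)) (hQ i)
    simp_rw [hcount]
    rw [lintegral_tsum fun i => (measurable_one.indicator (hm i)).aemeasurable]
    simp_rw [lintegral_indicator_one (hm _)]
    have hlt : k - 1 + ((m + 1 : ℕ) : ℤ) < n := by omega
    simp_rw [hl, h.measure_survives_inter z hlt]
    rw [ENNReal.tsum_mul_left, pow_succ', mul_assoc, ← ih]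
    congr 1
    simp_rw [count_eq_tsum]
    rw [lintegral_tsum]
    · refine tsum_congr fun i => ?_
      rw [← lintegral_indicator_one (hQ i)]
      refine lintegral_congr fun ω => ?_
      simp only [Set.indicator_apply, Set.mem_ofPred_eq, Pi.one_apply, hl]
      rfl
    · exact fun i => ((measurable_of_countable
        (fun l : List ℤ => if i < l.length ∧ l.getD i 0 = k then (1 : ℝ≥0∞) else 0)).comp
          hlm).aemeasurable

theorem measure_waveSize_ne_zero_le (h : IsCoefficients P φ Z B) (z : ℤ → ℕ) (j : ℕ) :
    P {ω | waveSize z (fun n k => B n k ω) (-(j : ℤ)) 0 ≠ 0} ≤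
      ENNReal.ofReal (∫ ω, φ 0 ω ∂P) ^ j * z (-(j : ℤ)) := by
  rw [← h.lintegral_count_population z (-(j : ℤ)) j]
  have hm : Measurable fun ω =>
      ((population z (fun n k => B n k ω) (-(j : ℤ) - 1) (j + 1)).count (-(j : ℤ)) : ℝ≥0∞) :=
    (measurable_of_countable fun l : List ℤ => (l.count (-(j : ℤ)) : ℝ≥0∞)).comp
      (h.measurable_population_right z _ _)
  have hle := mul_meas_ge_le_lintegral (μ := P) hm 1
  rw [one_mul] at hle
  refine le_trans (measure_mono ?_) hle
  intro ω hω
  have e : (0 - -(j : ℤ) + 1).toNat = j + 1 := by omega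
  rw [Set.mem_ofPred_eq, waveSize, e] at hω
  rw [Set.mem_ofPred_eq]
  exact_mod_cast Nat.one_le_iff_ne_zero.2 hω

/-- The mean of `Z 0` may be infinite, so the first-moment bound is used only where the wave started
with at most `a ^ j` immigrants. Independence allows the immigration to be frozen by Fubini. -/
theorem measure_wave_alive_le (h : IsCoefficients P φ Z B) {a : ℝ} (ha : 0 ≤ a) (j : ℕ) :
    P {ω | waveSize (fun m => Z m ω) (fun m k => B m k ω) (-(j : ℤ)) 0 ≠ 0} ≤
      P {ω | a ^ j < Z 0 ω} +
        (ENNReal.ofReal (∫ ω, φ 0 ω ∂P) * ENNReal.ofReal a) ^ j := by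
  set A : Set ((ℤ → ℕ) × (ℤ → ℕ → Bool)) := {x | waveSize x.1 x.2 (-(j : ℤ)) 0 ≠ 0}
  have hA : MeasurableSet A :=
    measurable_waveSize (-(j : ℤ)) 0 (DiscreteMeasurableSpace.forall_measurableSet {w : ℕ | w ≠ 0})
  have hZB : Measurable fun ω => ((fun n => Z n ω, fun n k => B n k ω) :
      (ℤ → ℕ) × (ℤ → ℕ → Bool)) := by simpa using h.measurable_coefficients 0
  have hB : Measurable fun ω n k => B n k ω := measurable_snd.comp hZB
  have hZ : Measurable fun ω n => Z n ω := measurable_fst.comp hZB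
  have hS : MeasurableSet {z : ℤ → ℕ | a ^ j < z (-(j : ℤ))} :=
    (measurable_pi_apply (-(j : ℤ)) : Measurable fun z : ℤ → ℕ => z (-(j : ℤ)))
      (DiscreteMeasurableSpace.forall_measurableSet {w : ℕ | a ^ j < w})
  have := Measure.isProbabilityMeasure_map hB.aemeasurable (μ := P)
  have := Measure.isProbabilityMeasure_map hZ.aemeasurable (μ := P)
  calc P {ω | waveSize (fun m => Z m ω) (fun m k => B m k ω) (-(j : ℤ)) 0 ≠ 0}
      = P.map (fun ω => (fun n => Z n ω, fun n k => B n k ω)) A := (Measure.map_apply hZB hA).symm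
    _ = ∫⁻ z, P.map (fun ω n k => B n k ω) (Prod.mk z ⁻¹' A) ∂P.map (fun ω n => Z n ω) := by
      rw [h.map_coefficients, Measure.prod_apply hA]
    _ ≤ ∫⁻ z, ({z : ℤ → ℕ | a ^ j < z (-(j : ℤ))}.indicator 1 z +
          (ENNReal.ofReal (∫ ω, φ 0 ω ∂P) * ENNReal.ofReal a) ^ j) ∂P.map (fun ω n => Z n ω) := by
      refine lintegral_mono fun z => ?_
      by_cases hz : a ^ j < z (-(j : ℤ))
      · rw [Set.indicator_of_mem (show z ∈ {z : ℤ → ℕ | a ^ j < z (-(j : ℤ))} from hz)]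
        exact le_add_right prob_le_one
      · rw [Set.indicator_of_notMem (show z ∉ {z : ℤ → ℕ | a ^ j < z (-(j : ℤ))} from hz), zero_add,
          Measure.map_apply hB (measurable_prodMk_left hA), mul_pow]
        refine (h.measure_waveSize_ne_zero_le z j).trans ?_
        gcongr
        rw [← ENNReal.ofReal_pow ha, ← ENNReal.ofReal_natCast]
        exact ENNReal.ofReal_le_ofReal (not_lt.1 hz)
    _ = P {ω | a ^ j < Z 0 ω} + (ENNReal.ofReal (∫ ω, φ 0 ω ∂P) * ENNReal.ofReal a) ^ j := by
      rw [lintegral_add_right _ measurable_const, lintegral_indicator_one hS, lintegral_const,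
        measure_univ, mul_one, Measure.map_apply hZ hS]
      congr 1
      exact (h.identDistrib_Z (-(j : ℤ))).measure_mem_eq
        (DiscreteMeasurableSpace.forall_measurableSet {w : ℕ | a ^ j < w})

end IsCoefficients

/-- A nonnegative random variable with a fractional moment has summable geometric tails. -/
theorem tsum_measure_pow_lt_ne_top {X : Ω → ℕ} (hX : Measurable X) {β a : ℝ} (hβ : 0 < β)
    (hint : Integrable (fun ω => (X ω : ℝ) ^ β) P) (ha : 1 < a) :
    ∑' j : ℕ, P {ω | a ^ j < X ω} ≠ ∞ := by
  have ha0 : 0 < a := by linarith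
  set c : ℝ≥0∞ := ENNReal.ofReal (a ^ β)
  have hc : 1 < c := by
    rw [← ENNReal.ofReal_one]
    exact (ENNReal.ofReal_lt_ofReal_iff (by positivity)).2 (Real.one_lt_rpow ha hβ)
  have hc0 : c ≠ 0 := (zero_lt_one.trans hc).ne'
  set M : ℝ≥0∞ := ∫⁻ ω, ENNReal.ofReal ((X ω : ℝ) ^ β) ∂P
  have hM : M ≠ ∞ := hint.lintegral_lt_top.ne
  have hmeas : Measurable fun ω => ENNReal.ofReal ((X ω : ℝ) ^ β) :=
    (measurable_of_countable fun x : ℕ => ENNReal.ofReal ((x : ℝ) ^ β)).comp hX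
  -- Markov's inequality for `X ^ β` at the level `(a ^ j) ^ β = c ^ j`.
  have hbound (j : ℕ) : P {ω | a ^ j < X ω} ≤ M * c⁻¹ ^ j := by
    rw [← ENNReal.inv_pow, ← div_eq_mul_inv]
    refine le_trans (measure_mono ?_) (meas_ge_le_lintegral_div hmeas.aemeasurable
      (pow_ne_zero j hc0) (by finiteness))
    intro ω hω
    rw [Set.mem_ofPred_eq] at hω ⊢
    rw [← ENNReal.ofReal_pow (by positivity), ← Real.rpow_natCast (a ^ β), ← Real.rpow_mul ha0.le,
      mul_comm β, Real.rpow_mul ha0.le, Real.rpow_natCast]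
    exact ENNReal.ofReal_le_ofReal (Real.rpow_le_rpow (by positivity) hω.le hβ.le)
  refine ne_top_of_le_ne_top ?_ (ENNReal.tsum_le_tsum hbound)
  rw [ENNReal.tsum_mul_left, ENNReal.tsum_geometric]
  refine ENNReal.mul_ne_top hM (ENNReal.inv_ne_top.2 (tsub_pos_of_lt ?_).ne')
  exact ENNReal.inv_lt_one.2 hc

/-- Almost surely, only finitely many immigration waves are alive at time `0`. -/
theorem IsCoefficients.ae_extinct [IsProbabilityMeasure P] (h : IsCoefficients P φ Z B)
    (h1 : P {ω | φ 0 ω = 1} < 1) {β : ℝ} (hβ : 0 < β) (hint : Integrable (fun ω => (Z 0 ω : ℝ) ^ β) P) :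
    ∀ᵐ ω ∂P, ∃ N : ℕ, ∀ j ≥ N,
      waveSize (fun m => Z m ω) (fun m k => B m k ω) (-(j : ℤ)) 0 = 0 := by
  set ρ : ℝ := ∫ ω, φ 0 ω ∂P with hρ
  have hρ0 : 0 ≤ ρ := integral_nonneg fun ω => (h.phi_mem 0 ω).1
  have hρ1 : ρ < 1 := h.integral_phi_lt_one h1
  obtain ⟨a, ha, hρa⟩ : ∃ a : ℝ, 1 < a ∧ ρ * a < 1 := by
    -- Both `1 < 2 / (1 + ρ)` and `2 * ρ / (1 + ρ) < 1` amount to `ρ < 1`.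
    refine ⟨2 / (1 + ρ), ?_, ?_⟩
    · rw [lt_div_iff₀ (by linarith)]; linarith
    · rw [← mul_div_assoc, div_lt_one (by linarith)]; linarith
  have hsum : ∑' j : ℕ, P {ω | waveSize (fun m => Z m ω) (fun m k => B m k ω) (-(j : ℤ)) 0 ≠ 0}
      ≠ ∞ := by
    refine ne_top_of_le_ne_top ?_
      (ENNReal.tsum_le_tsum fun j => h.measure_wave_alive_le (zero_le_one.trans ha.le) j)
    rw [ENNReal.tsum_add, ENNReal.tsum_geometric, ← hρ, ← ENNReal.ofReal_mul hρ0]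
    refine ENNReal.add_ne_top.2 ⟨tsum_measure_pow_lt_ne_top (h.measurable_Z 0) hβ hint ha,
      ENNReal.inv_ne_top.2 (tsub_pos_of_lt ?_).ne'⟩
    exact ENNReal.ofReal_lt_one.2 hρa
  -- Borel–Cantelli.
  filter_upwards [ae_eventually_notMem hsum] with ω hω
  simpa [eventually_atTop] using hω

end RCINAR

/-! ### The limiting population and convergence of the coalescence time -/

namespace RCINAR

variable {Ω : Type*} [MeasurableSpace Ω] {P : Measure Ω}

/-- In the discrete topology, convergence means eventual equality, so the measurable almost sure
limit is the eventual value. -/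
theorem exists_measurable_eventually_eq {X : ℕ → Ω → List ℤ} (hX : ∀ n, Measurable (X n))
    (h : ∀ᵐ ω ∂P, ∃ N, ∀ n ≥ N, X n ω = X N ω) :
    ∃ Y : Ω → List ℤ, Measurable Y ∧ ∀ᵐ ω ∂P, ∀ᶠ n in atTop, X n ω = Y ω := by
  let _ : TopologicalSpace (List ℤ) := ⊥
  have : DiscreteTopology (List ℤ) := ⟨rfl⟩
  obtain ⟨Y, hY, hlim⟩ := measurable_limit_of_tendsto_metrizable_ae (μ := P) (L := atTop)
    (fun n => (hX n).aemeasurable) (by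
      filter_upwards [h] with ω ⟨N, hN⟩
      exact ⟨X N ω, tendsto_const_nhds.congr' (eventually_atTop.2 ⟨N, fun n hn => (hN n hn).symm⟩)⟩)
  refine ⟨Y, hY, ?_⟩
  filter_upwards [hlim] with ω hω
  rwa [nhds_discrete, tendsto_pure] at hω

variable {φ : ℤ → Ω → ℝ} {Z : ℤ → Ω → ℕ} {B : ℤ → ℕ → Ω → Bool}

theorem IsCoefficients.measurable_population (h : IsCoefficients P φ Z B) (s : ℤ) (m : ℕ) :
    Measurable fun ω => population (fun m => Z m ω) (fun m k => B m k ω) s m := by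
  have := (RCINAR.measurable_population s m).comp (h.measurable_coefficients 0)
  simpa [Function.comp_def] using this

/-- The coalescence time at time `n` is distributed as that of a pair sampled at time `0` from
the process which is empty at time `-n`. -/
theorem IsCoefficients.measure_coalescenceTime [IsProbabilityMeasure P]
    (h : IsCoefficients P φ Z B) (n : ℕ) {I J : Ω → ℕ}
    (hIJ : IsUniformPair P (fun ω => population (fun m => Z m ω) (fun m k => B m k ω) 0 n) I J)
    (A : Set ℕ∞) :
    P {ω | coalescenceTime n (population (fun m => Z m ω) (fun m k => B m k ω) 0 n) (I ω) (J ω)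
        ∈ A} =
      ∫⁻ ω, pairLaw 0 (presentPopulation (fun m => Z m ω) (fun m k => B m k ω) n) A ∂P := by
  rw [hIJ.measure_coalescenceTime (h.measurable_population 0 n)]
  simp_rw [population_zero_eq_map, pairLaw_map_add]
  have hf : Measurable fun x : (ℤ → ℕ) × (ℤ → ℕ → Bool) =>
      pairLaw 0 (presentPopulation x.1 x.2 n) A :=
    (measurable_of_countable fun l => pairLaw 0 l A).comp (RCINAR.measurable_population _ n)
  have h1 := lintegral_map (μ := P) hf (h.measurable_coefficients n)
  have h2 := lintegral_map (μ := P) hf (h.measurable_coefficients 0)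
  rw [h.map_coefficients_shift] at h1 h2
  simpa using h1.symm.trans h2

end RCINAR

theorem proposition4 {Ω : Type*} [MeasurableSpace Ω] (P : Measure Ω) [IsProbabilityMeasure P]
    (φ : ℤ → Ω → ℝ) (Z : ℤ → Ω → ℕ) (B : ℤ → ℕ → Ω → Bool)
    (hcoef : RCINAR.IsCoefficients P φ Z B)
    (hA1 : P {ω | φ 0 ω = 1} < 1)
    (hA4 : ∃ β : ℝ, 0 < β ∧ Integrable (fun ω => (Z 0 ω : ℝ) ^ β) P)
    (G : ℕ → Ω → List ℤ)
    (hG : ∀ n ω, G n ω = RCINAR.population (fun m => Z m ω) (fun m k => B m k ω) 0 n)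
    (I J : ℕ → Ω → ℕ) (hIJ : ∀ n, RCINAR.IsUniformPair P (G n) (I n) (J n))
    (T : ℕ → Ω → ℕ∞)
    (hT : ∀ n ω, T n ω = RCINAR.coalescenceTime n (G n ω) (I n ω) (J n ω)) :
    (∀ᵐ ω ∂P, RCINAR.stationarySize (fun m => Z m ω) (fun m k => B m k ω) < ∞) ∧
    ∃ ν : ProbabilityMeasure ℕ∞,
      (∀ t : ℕ, (ν : Measure ℕ∞) (Set.Iic (t : ℕ∞)) =
        ∫⁻ ω, RCINAR.coalescenceRatio (fun m => Z m ω) (fun m k => B m k ω) t ∂P) ∧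
      TendstoInDistribution T atTop id (fun _ => P) (ν : Measure ℕ∞) ∧
      ∀ x : ℕ∞, Tendsto (fun n => P {ω | T n ω = x}) atTop (𝓝 ((ν : Measure ℕ∞) {x})) := by
  obtain ⟨β, hβ, hint⟩ := hA4
  have hext := hcoef.ae_extinct hA1 hβ hint
  obtain rfl : G = fun n ω => RCINAR.population (fun m => Z m ω) (fun m k => B m k ω) 0 n := by
    funext n ω; exact hG n ω
  obtain rfl : T = fun n ω => RCINAR.coalescenceTime n
      (RCINAR.population (fun m => Z m ω) (fun m k => B m k ω) 0 n) (I n ω) (J n ω) := by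
    funext n ω; exact hT n ω
  set X : ℕ → Ω → List ℤ := fun n ω =>
    RCINAR.presentPopulation (fun m => Z m ω) (fun m k => B m k ω) n
  have hX (n : ℕ) : Measurable (X n) := hcoef.measurable_population _ n
  obtain ⟨Y, hY, hXY⟩ := RCINAR.exists_measurable_eventually_eq (P := P) hX (by
    filter_upwards [hext] with ω ⟨N, hN⟩
    exact ⟨N, fun n hn => RCINAR.presentPopulation_eq_of_extinct hN hn⟩)
  have hκ : Measurable (RCINAR.pairLaw 0 ∘ Y) := (measurable_of_countable _).comp hY
  -- The limit law is that of a uniform pair from the stationary population `Y`, with mass at `⊤`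
  -- for pairs from different waves and for populations with no pair.
  set ν : Measure ℕ∞ := P.bind (RCINAR.pairLaw 0 ∘ Y) with hν
  have hνA (A : Set ℕ∞) : ν A = ∫⁻ ω, RCINAR.pairLaw 0 (Y ω) A ∂P :=
    Measure.bind_apply (DiscreteMeasurableSpace.forall_measurableSet A) hκ.aemeasurable
  have hνprob : IsProbabilityMeasure ν := ⟨by simp [hνA]⟩
  let ν' : ProbabilityMeasure ℕ∞ := ⟨ν, hνprob⟩
  have hTm (n : ℕ) := (hIJ n).measurable_coalescenceTime (hcoef.measurable_population 0 n) n
  -- Convergence on all sets: the integrands are bounded by `1` and almost surely eventually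
  -- constant in `n`.
  have hlim (A : Set ℕ∞) : Tendsto (fun n => P {ω | RCINAR.coalescenceTime n
      (RCINAR.population (fun m => Z m ω) (fun m k => B m k ω) 0 n) (I n ω) (J n ω) ∈ A})
      atTop (𝓝 (ν A)) := by
    simp_rw [fun n => hcoef.measure_coalescenceTime n (hIJ n) A, hνA]
    refine tendsto_lintegral_of_dominated_convergence (fun _ => 1)
      (fun n => (measurable_of_countable fun l => RCINAR.pairLaw 0 l A).comp (hX n))
      (fun n => ae_of_all _ fun ω => prob_le_one) (by simp) ?_
    filter_upwards [hXY] with ω hω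
    refine tendsto_const_nhds.congr' ?_
    filter_upwards [hω] with n hn
    rw [← hn]
  refine ⟨?_, ν', fun t => ?_, ?_, fun x => hlim {x}⟩
  · filter_upwards [hext] with ω ⟨N, hN⟩
    rw [RCINAR.stationarySize_eq_of_extinct hN]
    exact ENNReal.natCast_lt_top _
  · refine (hνA _).trans (lintegral_congr_ae ?_)
    filter_upwards [hext, hXY] with ω ⟨N, hN⟩ hω
    -- Here `n ≥ N` puts every surviving wave into the population, and `n > t` makes each wave `0,
    -- …, -t` of the numerator one that arrived after the start.
    obtain ⟨n, hn, hNn, htn⟩ :=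
      (hω.and ((eventually_ge_atTop N).and (eventually_gt_atTop t))).exists
    rw [← hn, RCINAR.pairLaw_Iic fun a ha => (RCINAR.mem_presentPopulation ha).2,
      RCINAR.coalescenceRatio,
      RCINAR.stationarySize_eq_of_extinct (N := n) fun j hj => hN j (hNn.trans hj)]
    congr 1
    refine Finset.sum_congr rfl fun j hj => ?_
    rw [RCINAR.count_presentPopulation (by rw [Finset.mem_range] at hj; omega)]
  · refine ⟨fun n => (hTm n).aemeasurable, aemeasurable_id, ?_⟩
    -- Of the setwise convergence, the portmanteau theorem needs only the lower bound on open sets.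
    refine tendsto_of_forall_isOpen_le_liminf' fun U hU => ?_
    have hUm : MeasurableSet U := DiscreteMeasurableSpace.forall_measurableSet U
    have := (hlim U).liminf_eq
    simp only [ProbabilityMeasure.coe_mk, Measure.map_id]
    simp_rw [Measure.map_apply (hTm _) hUm]
    exact this.ge
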